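/- Let $N_t\ge 1$, $M\ge 1$ and $P>0$ be fixed, put $\gamma=P/N_t$, and let $\mathbf h_1,\mathbf h_2,\dots$ be i.i.d. random vectors in $\mathbb C^{N_t}$ whose coefficients are i.i.d. $\mathcal{CN}(0,1)$. Put $\rho_u=\|\mathbf h_u\|^2$ and $\mathbf s_u=\mathbf h_u/\|\mathbf h_u\|$. Let the codebook $\mathcal F=\{\mathbf v^{(m)}_n : 1\le m\le M,\ 1\le n\le N_t\}$ consist of $M$ orthonormal bases $(\mathbf v^{(m)}_n)_{1\le n\le N_t}$ of $\mathbb C^{N_t}$, and let $d(\mathbf v,\mathbf s)=1-|\mathbf v^\dagger\mathbf s|^2$. For a number $U$ of users define $$\epsilon_u=\min_{\mathbf v\in\mathcal F} d(\mathbf v,\mathbf s_u),\qquad \mathrm{SINR}_u=\frac{\gamma\rho_u(1-\epsilon_u)}{1+\gamma\rho_u\epsilon_u},$$ $$\mathcal I^{(m)}_n=\{1\le u\le U : d(\mathbf v^{(m)}_n,\mathbf s_u)<d(\mathbf v,\mathbf s_u)\ \text{for all } \mathbf v\in\mathcal F,\ \mathbf v\ne\mathbf v^{(m)}_n\},$$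 $$R=\mathbb E\Big[\max_{1\le m\le M}\sum_{n=1}^{N_t}\log\Big(1+\max_{u\in\mathcal I^{(m)}_n}\mathrm{SINR}_u\Big)\Big],$$ where a maximum over an empty set of users is $0$. Then $R$ (the ergodic PU2RC throughput in the normal SNR regime) is a finite expectation for every $U$, and $$\lim_{U\to\infty}\frac{R}{N_t\log\log U}=1$$ in each of the following two cases: (i) $\mathcal F$ is deterministic and no two distinct vectors of $\mathcal F$ are collinear; (ii) $N_t\ge 2$ and $\mathcal F$ is random, its $M$ bases being the columns of $M$ independent Haar-distributed unitary matrices that are independent of the channels, with the expectation in $R$ taken over both channels and codebook. -/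

import Mathlib

open MeasureTheory ProbabilityTheory Filter Topology

namespace PU2RC

/-- The space `ℂ^N` of channel and beamforming vectors, with its Hermitian norm. -/
abbrev CVec (N : ℕ) : Type := EuclideanSpace ℂ (Fin N)

/-- A family of `M` lists of `N` vectors of `ℂ^N`; `F m n` is the `n`-th vector of the `m`-th
list. -/
abbrev Codebook (N M : ℕ) : Type := Fin M → Fin N → CVec N

/-- The codebook consists of `M` orthonormal bases of `ℂ^N` (`N` orthonormal vectors of `ℂ^N` are
a basis), and two distinct codewords are never collinear, that is, they are distinct beams. -/
structure IsCodebook {N M : ℕ} (F : Codebook N M) : Prop where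
  orthonormal : ∀ m, Orthonormal ℂ (F m)
  noncollinear : ∀ m n m' n', F m' n' ≠ F m n → ‖inner ℂ (F m n) (F m' n')‖ < 1

/-- The circularly symmetric complex Gaussian distribution `CN(0,1)`: independent real and
imaginary parts, each of them `N(0,1/2)`. -/
noncomputable def complexGaussian : Measure ℂ :=
  ((gaussianReal 0 (1 / 2)).prod (gaussianReal 0 (1 / 2))).map Complex.measurableEquivRealProd.symm

/-- The law of a vector of `ℂ^N` with i.i.d. `CN(0,1)` coefficients. -/
noncomputable def channelLaw (N : ℕ) : Measure (CVec N) :=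
  (Measure.pi fun _ : Fin N => complexGaussian).map (MeasurableEquiv.toLp 2 (Fin N → ℂ))

/-- The channel shape `s = h / ‖h‖`. -/
noncomputable def shape {N : ℕ} (h : CVec N) : CVec N := ((‖h‖⁻¹ : ℝ) : ℂ) • h

/-- The distortion `d(v, s) = 1 - |v† s|²`. -/
noncomputable def distortion {N : ℕ} (v s : CVec N) : ℝ := 1 - ‖inner ℂ v s‖ ^ 2

/-- The quantization error of a user with channel `h`: the smallest distortion between the channel
shape and a codeword (a minimum over finitely many codewords). -/
noncomputable def quantError {N M : ℕ} (F : Codebook N M) (h : CVec N) : ℝ :=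
  ⨅ p : Fin M × Fin N, distortion (F p.1 p.2) (shape h)

/-- `SINR = γ ρ (1 - ε) / (1 + γ ρ ε)`, with channel power `ρ = ‖h‖²`, quantization error `ε` and
SNR `γ`. -/
noncomputable def sinr {N M : ℕ} (γ : ℝ) (F : Codebook N M) (h : CVec N) : ℝ :=
  γ * ‖h‖ ^ 2 * (1 - quantError F h) / (1 + γ * ‖h‖ ^ 2 * quantError F h)

open Classical in
/-- The set of those among the users `0, …, U - 1` whose channel shape is strictly closer to the
codeword `F m n` than to any other codeword; `h u` is the channel of user `u`. -/
noncomputable def users {N M : ℕ} (F : Codebook N M) (h : ℕ → CVec N) (U : ℕ)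
    (m : Fin M) (n : Fin N) : Finset ℕ :=
  (Finset.range U).filter fun u => ∀ m' n', F m' n' ≠ F m n →
    distortion (F m n) (shape (h u)) < distortion (F m' n') (shape (h u))

open Classical in
/-- The largest SINR of a user associated with the codeword `F m n`, and zero if there is no such
user. -/
noncomputable def maxSinr {N M : ℕ} (γ : ℝ) (F : Codebook N M) (h : ℕ → CVec N) (U : ℕ)
    (m : Fin M) (n : Fin N) : ℝ :=
  if hne : (users F h U m n).Nonempty then
    (users F h U m n).sup' hne fun u => sinr γ F (h u)
  else 0

/-- The sum rate of the scheduled users: the maximum over the `M` bases of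
`∑ n, log (1 + max SINR)`. -/
noncomputable def sumRate {N M : ℕ} (γ : ℝ) (F : Codebook N M) (h : ℕ → CVec N) (U : ℕ) : ℝ :=
  ⨆ m : Fin M, ∑ n : Fin N, Real.log (1 + maxSinr γ F h U m n)

/-- The ergodic throughput `R` with `U` users: the expected sum rate. The codebook and the channels
may both be random. -/
noncomputable def throughput {Ω : Type*} [MeasurableSpace Ω] (μ : Measure Ω) {N M : ℕ} (γ : ℝ)
    (F : Ω → Codebook N M) (H : ℕ → Ω → CVec N) (U : ℕ) : ℝ :=
  ∫ ω, sumRate γ (F ω) (fun u => H u ω) U ∂μ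

/-- The throughput is a genuine expectation for every number `U` of users, and
`R / (N log log U) → 1` as `U → ∞`. -/
def ScalingLaw {Ω : Type*} [MeasurableSpace Ω] (μ : Measure Ω) {N M : ℕ} (γ : ℝ)
    (F : Ω → Codebook N M) (H : ℕ → Ω → CVec N) : Prop :=
  (∀ U, Integrable (fun ω => sumRate γ (F ω) (fun u => H u ω) U) μ) ∧
    Tendsto (fun U : ℕ => throughput μ γ F H U / (N * Real.log (Real.log U))) atTop (𝓝 1)

/-- The group of unitary `N × N` matrices. -/
abbrev UnitaryMat (N : ℕ) : Type := Matrix.unitaryGroup (Fin N) ℂ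

noncomputable instance (N : ℕ) : MeasurableSpace (UnitaryMat N) := borel _

instance (N : ℕ) : BorelSpace (UnitaryMat N) := ⟨rfl⟩

instance (N : ℕ) : CompactSpace (UnitaryMat N) := by
  refine isCompact_iff_compactSpace.mp (?_ : IsCompact
    (Matrix.unitaryGroup (Fin N) ℂ : Set (Matrix (Fin N) (Fin N) ℂ)))
  have hK : IsCompact (Set.univ.pi fun _ : Fin N => Set.univ.pi fun _ : Fin N =>
      Metric.closedBall (0 : ℂ) 1) :=
    isCompact_univ_pi fun _ => isCompact_univ_pi fun _ => isCompact_closedBall 0 1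
  refine hK.of_isClosed_subset (isClosed_unitary (R := Matrix (Fin N) (Fin N) ℂ)) ?_
  intro A hA i _ j _
  simpa using entry_norm_bound_of_unitary hA i j

/-- The Haar probability measure on the unitary group. -/
noncomputable def haarUnitary (N : ℕ) : Measure (UnitaryMat N) :=
  Measure.haarMeasure (⊤ : TopologicalSpace.PositiveCompacts (UnitaryMat N))

/-- The codebook whose `m`-th orthonormal basis consists of the columns of the unitary matrix
`B m`. -/
def codebookOfUnitary {N M : ℕ} (B : Fin M → UnitaryMat N) : Codebook N M :=
  fun m n => WithLp.toLp 2 fun i => (B m).1 i n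

end PU2RC

/-! Both bounds hold for a codebook independent of the channels; a deterministic codebook is a
constant one.

Upper bound: SINR never exceeds `γ‖h‖²`, and `E exp(‖h‖²/2)` is finite. Replacing the maximum of `‖h
u‖²` by the smooth bound `L + 2 exp(-L/2) ∑ exp(‖h u‖²/2)` with `L = 2 log U` gives `R ≤ N log(1 +
2γ log U) + O(1)` (`sumRate_le_log_add`, `integral_sumRate_le`).

Lower bound: serve one fixed basis and look for users in the unit ball around `r v`, `v` a codeword
and `r = κ√(log U)`. Such a user is associated with `v` once `r` is large compared with the gap
between 1 and the coherence, and its interference `‖h‖²ε` is at most 1, so its SINR is of order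
`r²`, that is `log U` (`mem_users_of_near`, `le_sinr_of_near`). The ball has mass at least `c exp(-K
r²)`; for small `κ` this is `c U^(-1/2)`, so every codeword of the basis finds such a user with
probability tending to 1 (`le_integral_sumRate`). For a random codebook the coherence stays below
some `β < 1` outside an event of small probability (`exists_measure_coherenceLE_compl_le`).

For Haar bases it remains to see that distinct codewords are almost surely not collinear
(`haarUnitary_aligned_eq_zero`). -/

namespace PU2RC

/-! ### Pointwise bounds for a fixed codebook and fixed channels -/

section Deterministic

variable {N M : ℕ} {γ : ℝ} {F : Codebook N M}

lemma norm_inner_shape (v h : CVec N) : ‖inner ℂ v (shape h)‖ = ‖h‖⁻¹ * ‖inner ℂ v h‖ := by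
  rw [shape, inner_smul_right, norm_mul, Complex.norm_real, norm_inv, norm_norm]

lemma distortion_shape_nonneg {v : CVec N} (hv : ‖v‖ = 1) (h : CVec N) :
    0 ≤ distortion v (shape h) := by
  have h1 : ‖inner ℂ v (shape h)‖ ≤ 1 := by
    rw [norm_inner_shape]
    calc ‖h‖⁻¹ * ‖inner ℂ v h‖ ≤ ‖h‖⁻¹ * (‖v‖ * ‖h‖) := by
          gcongr; exact norm_inner_le_norm v h
      _ = ‖h‖⁻¹ * ‖h‖ := by rw [hv, one_mul]
      -- Not an equality: `shape 0 = 0`.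
      _ ≤ 1 := inv_mul_le_one
  unfold distortion
  nlinarith [norm_nonneg (inner ℂ v (shape h))]

lemma distortion_le_one (v s : CVec N) : distortion v s ≤ 1 := by
  unfold distortion
  nlinarith [sq_nonneg ‖inner ℂ v s‖]

lemma quantError_le (F : Codebook N M) (h : CVec N) (m : Fin M) (n : Fin N) :
    quantError F h ≤ distortion (F m n) (shape h) :=
  ciInf_le (f := fun p : Fin M × Fin N => distortion (F p.1 p.2) (shape h))
    (Set.finite_range _).bddBelow (m, n)

lemma quantError_nonneg (hF : IsCodebook F) (h : CVec N) : 0 ≤ quantError F h :=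
  Real.iInf_nonneg fun p => distortion_shape_nonneg ((hF.orthonormal p.1).1 p.2) h

lemma quantError_le_one (F : Codebook N M) (h : CVec N) : quantError F h ≤ 1 := by
  rcases isEmpty_or_nonempty (Fin M × Fin N) with hE | ⟨⟨m, n⟩⟩
  · rw [quantError, Real.iInf_of_isEmpty]
    exact zero_le_one
  · exact (quantError_le F h m n).trans (distortion_le_one _ _)

lemma sinr_nonneg (hγ : 0 ≤ γ) (hF : IsCodebook F) (h : CVec N) : 0 ≤ sinr γ F h := by
  have h0 := quantError_nonneg hF h
  have h1 : 0 ≤ 1 - quantError F h := sub_nonneg.2 (quantError_le_one F h)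
  unfold sinr
  positivity

lemma sinr_le (hγ : 0 ≤ γ) (hF : IsCodebook F) (h : CVec N) : sinr γ F h ≤ γ * ‖h‖ ^ 2 := by
  have h0 := quantError_nonneg hF h
  have hρ : 0 ≤ γ * ‖h‖ ^ 2 := by positivity
  have h2 : 0 ≤ γ * ‖h‖ ^ 2 * quantError F h := mul_nonneg hρ h0
  unfold sinr
  rw [div_le_iff₀ (by positivity)]
  nlinarith [mul_nonneg hρ h2]

lemma maxSinr_nonneg (hγ : 0 ≤ γ) (hF : IsCodebook F) (h : ℕ → CVec N) (U : ℕ)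
    (m : Fin M) (n : Fin N) : 0 ≤ maxSinr γ F h U m n := by
  unfold maxSinr
  split_ifs with hne
  · obtain ⟨u, hu⟩ := hne
    exact (sinr_nonneg hγ hF (h u)).trans (Finset.le_sup' (fun u => sinr γ F (h u)) hu)
  · exact le_rfl

lemma maxSinr_le (hγ : 0 ≤ γ) (hF : IsCodebook F) {h : ℕ → CVec N} {U : ℕ} {K : ℝ} (hK : 0 ≤ K)
    (hh : ∀ u < U, γ * ‖h u‖ ^ 2 ≤ K) (m : Fin M) (n : Fin N) : maxSinr γ F h U m n ≤ K := by
  unfold maxSinr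
  split_ifs with hne
  · refine Finset.sup'_le _ _ fun u hu => (sinr_le hγ hF (h u)).trans (hh u ?_)
    exact Finset.mem_range.1 (Finset.mem_filter.1 hu).1
  · exact hK

lemma sinr_le_maxSinr {h : ℕ → CVec N} {U : ℕ} {m : Fin M} {n : Fin N} {u : ℕ}
    (hu : u ∈ users F h U m n) : sinr γ F (h u) ≤ maxSinr γ F h U m n := by
  have hne : (users F h U m n).Nonempty := ⟨u, hu⟩
  rw [maxSinr, dif_pos hne]
  exact Finset.le_sup' (fun u => sinr γ F (h u)) hu

lemma sumRate_nonneg (hγ : 0 ≤ γ) (hF : IsCodebook F) (h : ℕ → CVec N) (U : ℕ) :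
    0 ≤ sumRate γ F h U :=
  Real.iSup_nonneg fun m => Finset.sum_nonneg fun n _ =>
    Real.log_nonneg (by linarith [maxSinr_nonneg hγ hF h U m n])

lemma sumRate_le (hγ : 0 ≤ γ) (hF : IsCodebook F) {h : ℕ → CVec N} {U : ℕ} {K : ℝ} (hK : 0 ≤ K)
    (hh : ∀ u < U, γ * ‖h u‖ ^ 2 ≤ K) : sumRate γ F h U ≤ N * Real.log (1 + K) := by
  refine Real.iSup_le (fun m => ?_)
    (mul_nonneg (Nat.cast_nonneg _) (Real.log_nonneg (by linarith)))
  calc ∑ n : Fin N, Real.log (1 + maxSinr γ F h U m n) ≤ ∑ _n : Fin N, Real.log (1 + K) := by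
        refine Finset.sum_le_sum fun n _ => Real.log_le_log ?_ ?_
        · linarith [maxSinr_nonneg hγ hF h U m n]
        · linarith [maxSinr_le hγ hF hK hh m n]
    _ = N * Real.log (1 + K) := by simp

lemma le_sumRate {h : ℕ → CVec N} {U : ℕ} {s : ℝ} (hs : 0 ≤ s) (m : Fin M)
    (hu : ∀ n, ∃ u ∈ users F h U m n, s ≤ sinr γ F (h u)) :
    N * Real.log (1 + s) ≤ sumRate γ F h U := by
  refine le_trans ?_ (le_ciSup (f := fun m => ∑ n : Fin N, Real.log (1 + maxSinr γ F h U m n))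
    (Set.finite_range _).bddAbove m)
  calc N * Real.log (1 + s) = ∑ _n : Fin N, Real.log (1 + s) := by simp
    _ ≤ _ := by
        refine Finset.sum_le_sum fun n _ => Real.log_le_log (by linarith) ?_
        obtain ⟨u, hu, hsu⟩ := hu n
        linarith [sinr_le_maxSinr (γ := γ) hu]

/-- The interference power of a channel close to a multiple of a unit vector is bounded. -/
lemma norm_sq_sub_inner_sq_le_one {v h : CVec N} (hv : ‖v‖ = 1) {r : ℝ}
    (hh : ‖h - (r : ℂ) • v‖ ≤ 1) : ‖h‖ ^ 2 - ‖inner ℂ v h‖ ^ 2 ≤ 1 := by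
  set e := h - (r : ℂ) • v with he
  have hh' : h = (r : ℂ) • v + e := by rw [he]; abel
  have hin : inner ℂ v h = (r : ℂ) + inner ℂ v e := by
    rw [hh', inner_add_right, inner_smul_right, inner_self_eq_norm_sq_to_K, hv]; simp
  have hn : ‖h‖ ^ 2 = r ^ 2 + 2 * r * (inner ℂ v e : ℂ).re + ‖e‖ ^ 2 := by
    rw [hh', norm_add_sq (𝕜 := ℂ), norm_smul, hv, inner_smul_left]
    simp [mul_assoc]
  have hin2 : ‖(inner ℂ v h : ℂ)‖ ^ 2 = r ^ 2 + 2 * r * (inner ℂ v e : ℂ).re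
      + ‖(inner ℂ v e : ℂ)‖ ^ 2 := by
    rw [hin]
    generalize (inner ℂ v e : ℂ) = z
    rw [← Complex.normSq_eq_norm_sq, ← Complex.normSq_eq_norm_sq]
    simp [Complex.normSq_apply]; ring
  -- The terms in `r` cancel: the difference is `‖e‖² - |⟨v, e⟩|²`.
  rw [hn, hin2]
  nlinarith [norm_nonneg e, sq_nonneg ‖(inner ℂ v e : ℂ)‖]

lemma le_norm_inner_of_near {v h : CVec N} (hv : ‖v‖ = 1) {r : ℝ} (hr : 0 ≤ r)
    (hh : ‖h - (r : ℂ) • v‖ ≤ 1) : r - 1 ≤ ‖(inner ℂ v h : ℂ)‖ := by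
  have h1 : inner ℂ v h = (r : ℂ) + inner ℂ v (h - (r : ℂ) • v) := by
    rw [inner_sub_right, inner_smul_right, inner_self_eq_norm_sq_to_K, hv]; simp
  have h2 : ‖(inner ℂ v (h - (r : ℂ) • v) : ℂ)‖ ≤ 1 := by
    refine (norm_inner_le_norm _ _).trans ?_
    rwa [hv, one_mul]
  have h3 := norm_sub_le_norm_add (r : ℂ) (inner ℂ v (h - (r : ℂ) • v))
  rw [← h1, Complex.norm_real, Real.norm_of_nonneg hr] at h3
  linarith

lemma norm_inner_le_of_near {v w h : CVec N} (hw : ‖w‖ = 1) {r β : ℝ} (hr : 0 ≤ r)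
    (hh : ‖h - (r : ℂ) • v‖ ≤ 1) (hvw : ‖(inner ℂ v w : ℂ)‖ ≤ β) :
    ‖(inner ℂ w h : ℂ)‖ ≤ β * r + 1 := by
  have h1 : inner ℂ w h = (r : ℂ) * inner ℂ w v + inner ℂ w (h - (r : ℂ) • v) := by
    rw [inner_sub_right, inner_smul_right]; ring
  have h2 : ‖(inner ℂ w (h - (r : ℂ) • v) : ℂ)‖ ≤ 1 := by
    refine (norm_inner_le_norm _ _).trans ?_
    rwa [hw, one_mul]
  rw [h1]
  refine (norm_add_le _ _).trans ?_
  rw [norm_mul, Complex.norm_real, Real.norm_of_nonneg hr, norm_inner_symm]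
  nlinarith

/-- A user whose channel is close to a long multiple of a codeword is associated with that
codeword. -/
lemma mem_users_of_near (hF : IsCodebook F) {h : ℕ → CVec N} {U u : ℕ} (hu : u < U)
    {m : Fin M} {n : Fin N} {r β : ℝ} (hr : 0 ≤ r) (hrβ : 2 < r * (1 - β))
    (hFβ : ∀ m' n', F m' n' ≠ F m n → ‖(inner ℂ (F m n) (F m' n') : ℂ)‖ ≤ β)
    (hh : ‖h u - (r : ℂ) • F m n‖ ≤ 1) : u ∈ users F h U m n := by
  refine Finset.mem_filter.2 ⟨Finset.mem_range.2 hu, fun m' n' hne => ?_⟩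
  have h1 := le_norm_inner_of_near ((hF.orthonormal m).1 n) hr hh
  have h2 := norm_inner_le_of_near ((hF.orthonormal m').1 n') hr hh (hFβ m' n' hne)
  -- `β r + 1 < r - 1` is the hypothesis `hrβ` rearranged.
  have h3 : ‖(inner ℂ (F m' n') (h u) : ℂ)‖ < ‖(inner ℂ (F m n) (h u) : ℂ)‖ := by
    nlinarith
  have hpos : 0 < ‖h u‖ := by
    refine norm_pos_iff.2 fun h0 => ?_
    simp [h0] at h3
  unfold distortion
  rw [norm_inner_shape, norm_inner_shape]
  have h4 : ‖h u‖⁻¹ * ‖(inner ℂ (F m' n') (h u) : ℂ)‖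
      < ‖h u‖⁻¹ * ‖(inner ℂ (F m n) (h u) : ℂ)‖ := by gcongr
  have h5 : 0 ≤ ‖h u‖⁻¹ * ‖(inner ℂ (F m' n') (h u) : ℂ)‖ := by positivity
  nlinarith

/-- With `v = F m n`, the signal part `‖h‖²(1 - ε)` is at least `|⟨v, h⟩|² ≥ (r - 1)²`, while the
interference `‖h‖²ε` is at most the squared norm of the component of `h` orthogonal to `v`, hence at
most 1 whatever `r` is. -/
lemma le_sinr_of_near (hγ : 0 < γ) (hF : IsCodebook F) {h : CVec N}
    {m : Fin M} {n : Fin N} {r : ℝ} (hr : 1 < r)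
    (hh : ‖h - (r : ℂ) • F m n‖ ≤ 1) : γ * (r - 1) ^ 2 / (1 + γ) ≤ sinr γ F h := by
  have hv := (hF.orthonormal m).1 n
  have h1 := le_norm_inner_of_near hv (by linarith) hh
  have h2 := norm_sq_sub_inner_sq_le_one hv hh
  have hpos : 0 < ‖h‖ := by
    refine norm_pos_iff.2 fun h0 => ?_
    simp [h0] at h1
    linarith
  have hq0 := quantError_nonneg hF h
  have hq := quantError_le F h m n
  rw [distortion, norm_inner_shape] at hq
  have hq' : ‖h‖ ^ 2 * quantError F h ≤ ‖h‖ ^ 2 - ‖(inner ℂ (F m n) h : ℂ)‖ ^ 2 := by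
    calc ‖h‖ ^ 2 * quantError F h
        ≤ ‖h‖ ^ 2 * (1 - (‖h‖⁻¹ * ‖(inner ℂ (F m n) h : ℂ)‖) ^ 2) := by gcongr
      _ = _ := by field_simp
  have ha : (r - 1) ^ 2 ≤ ‖h‖ ^ 2 * (1 - quantError F h) := by nlinarith
  have hb : ‖h‖ ^ 2 * quantError F h ≤ 1 := hq'.trans h2
  have hb0 : 0 ≤ ‖h‖ ^ 2 * quantError F h := by positivity
  unfold sinr
  rw [mul_assoc, mul_assoc]
  gcongr
  · exact mul_nonneg hγ.le ((sq_nonneg _).trans ha)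
  · exact mul_le_of_le_one_right hγ.le hb

end Deterministic

end PU2RC

namespace PU2RC

/-! ### Gaussian channel law: exponential moment and small-ball estimate -/

section ChannelLaw

instance : IsProbabilityMeasure complexGaussian := by
  unfold complexGaussian
  exact Measure.isProbabilityMeasure_map (by fun_prop)

instance (N : ℕ) : IsProbabilityMeasure (channelLaw N) := by
  unfold channelLaw
  exact Measure.isProbabilityMeasure_map (by fun_prop)

lemma gaussianPDFReal_half (x : ℝ) :
    gaussianPDFReal 0 (1 / 2) x = (√Real.pi)⁻¹ * Real.exp (-x ^ 2) := by
  rw [gaussianPDFReal]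
  congr 2
  · congr 1; push_cast; ring
  · push_cast; ring

/-- At variance 1/2 the density is proportional to `exp(-x²)`, so a factor `exp(-x²/2)` remains. -/
lemma integrable_exp_half_sq_gaussianReal :
    Integrable (fun x : ℝ => Real.exp (x ^ 2 / 2)) (gaussianReal 0 (1 / 2)) := by
  rw [gaussianReal_of_var_ne_zero _ (by norm_num), integrable_withDensity_iff_integrable_smul'
    (measurable_gaussianPDF _ _) (ae_of_all _ fun x => gaussianPDF_lt_top)]
  refine ((integrable_exp_neg_mul_sq (b := 1 / 2) (by norm_num)).const_mul
    (√Real.pi)⁻¹).congr (ae_of_all _ fun x => ?_)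
  simp only [toReal_gaussianPDF, gaussianPDFReal_half, smul_eq_mul]
  rw [mul_assoc, ← Real.exp_add]
  congr 2
  ring

lemma integrable_exp_half_norm_sq_complexGaussian :
    Integrable (fun z : ℂ => Real.exp (‖z‖ ^ 2 / 2)) complexGaussian := by
  unfold complexGaussian
  rw [integrable_map_equiv]
  refine (integrable_exp_half_sq_gaussianReal.mul_prod
    integrable_exp_half_sq_gaussianReal).congr (ae_of_all _ fun z => ?_)
  simp only [Function.comp_apply]
  rw [← Complex.normSq_eq_norm_sq, ← Real.exp_add, Complex.normSq_apply,
    Complex.measurableEquivRealProd_symm_apply]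
  congr 1
  ring

lemma integrable_exp_half_norm_sq_channelLaw (N : ℕ) :
    Integrable (fun h : CVec N => Real.exp (‖h‖ ^ 2 / 2)) (channelLaw N) := by
  unfold channelLaw
  rw [integrable_map_equiv]
  refine (Integrable.fintype_prod (ι := Fin N) (f := fun _ z => Real.exp (‖z‖ ^ 2 / 2))
    fun _ => integrable_exp_half_norm_sq_complexGaussian).congr (ae_of_all _ fun z => ?_)
  simp only [Function.comp_apply, EuclideanSpace.norm_sq_eq, ← Real.exp_sum, Finset.sum_div,
    MeasurableEquiv.coe_toLp]

lemma le_gaussianReal_Icc {δ : ℝ} (hδ : δ ≤ 1) {x r : ℝ} (hx : |x| ≤ r) :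
    ENNReal.ofReal (2 * δ * (√Real.pi)⁻¹ * Real.exp (-(r + 1) ^ 2))
      ≤ gaussianReal 0 (1 / 2) (Set.Icc (x - δ) (x + δ)) := by
  rw [gaussianReal_apply _ (by norm_num)]
  calc ENNReal.ofReal (2 * δ * (√Real.pi)⁻¹ * Real.exp (-(r + 1) ^ 2))
      = ∫⁻ _y in Set.Icc (x - δ) (x + δ),
          ENNReal.ofReal ((√Real.pi)⁻¹ * Real.exp (-(r + 1) ^ 2)) := by
        rw [setLIntegral_const, Real.volume_Icc, ← ENNReal.ofReal_mul (by positivity)]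
        congr 1; ring
    _ ≤ _ := by
        refine setLIntegral_mono (measurable_gaussianPDF _ _) fun y hy => ?_
        rw [gaussianPDF, gaussianPDFReal_half]
        refine ENNReal.ofReal_le_ofReal ?_
        gcongr 2
        have : |y| ≤ r + 1 := by
          rw [abs_le] at hx ⊢
          constructor <;> linarith [hy.1, hy.2]
        have h2 : |y| ^ 2 ≤ (r + 1) ^ 2 := by gcongr
        rw [sq_abs] at h2
        linarith

lemma le_complexGaussian_box {δ : ℝ} (hδ : δ ≤ 1) {z : ℂ} {r : ℝ} (hz : ‖z‖ ≤ r) :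
    ENNReal.ofReal (2 * δ * (√Real.pi)⁻¹ * Real.exp (-(r + 1) ^ 2)) ^ 2
      ≤ complexGaussian {w | ‖w - z‖ ≤ 2 * δ} := by
  calc _ ≤ gaussianReal 0 (1 / 2) (Set.Icc (z.re - δ) (z.re + δ)) *
        gaussianReal 0 (1 / 2) (Set.Icc (z.im - δ) (z.im + δ)) := by
        rw [sq]
        gcongr
        · exact le_gaussianReal_Icc hδ ((Complex.abs_re_le_norm z).trans hz)
        · exact le_gaussianReal_Icc hδ ((Complex.abs_im_le_norm z).trans hz)
    _ ≤ _ := by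
        rw [complexGaussian, MeasurableEquiv.map_apply, ← Measure.prod_prod]
        refine measure_mono fun p hp => ?_
        obtain ⟨h1, h2⟩ := hp
        simp only [Set.mem_preimage, Set.mem_ofPred_eq,
          Complex.measurableEquivRealProd_symm_apply]
        refine (Complex.norm_le_abs_re_add_abs_im _).trans ?_
        have h3 : |p.1 - z.re| ≤ δ := abs_le.2 ⟨by linarith [h1.1], by linarith [h1.2]⟩
        have h4 : |p.2 - z.im| ≤ δ := abs_le.2 ⟨by linarith [h2.1], by linarith [h2.2]⟩
        simp only [Complex.sub_re, Complex.sub_im]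
        linarith

/-- The channel law has a Gaussian lower bound on the mass of unit balls. -/
lemma exists_le_channelLaw_closedBall (N : ℕ) : ∃ c K : ℝ, 0 < c ∧ 0 < K ∧
    ∀ (w : CVec N) (r : ℝ), 1 ≤ r → ‖w‖ ≤ r →
      ENNReal.ofReal (c * Real.exp (-K * r ^ 2)) ≤ channelLaw N {h | ‖h - w‖ ≤ 1} := by
  -- Coordinates within `2δ = 1/(N+1)` of those of `w` give a squared distance of at most `N/(N+1)²
  -- ≤ 1`.
  set δ : ℝ := 1 / (2 * (N + 1)) with hδ
  have hδ0 : 0 < δ := by positivity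
  have hδ1 : δ ≤ 1 := by
    rw [hδ, div_le_one (by positivity)]; linarith [(Nat.cast_nonneg N : (0 : ℝ) ≤ N)]
  -- There are `2N` real coordinates and `(r + 1)² ≤ 4r²`, whence `8N`; the extra 1 keeps the
  -- constant positive when `N = 0`.
  refine ⟨(2 * δ * (√Real.pi)⁻¹) ^ (2 * N), 8 * N + 1, by positivity, by positivity,
    fun w r hr hw => ?_⟩
  calc ENNReal.ofReal ((2 * δ * (√Real.pi)⁻¹) ^ (2 * N) * Real.exp (-(8 * N + 1) * r ^ 2))
      ≤ ENNReal.ofReal ((2 * δ * (√Real.pi)⁻¹ * Real.exp (-(r + 1) ^ 2)) ^ (2 * N)) := by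
        refine ENNReal.ofReal_le_ofReal ?_
        rw [mul_pow _ (Real.exp _), ← Real.exp_nat_mul]
        refine mul_le_mul_of_nonneg_left (Real.exp_le_exp.2 ?_) (by positivity)
        push_cast
        have : (r + 1) ^ 2 ≤ 4 * r ^ 2 := by nlinarith
        nlinarith [(Nat.cast_nonneg N : (0 : ℝ) ≤ N), sq_nonneg r,
          mul_le_mul_of_nonneg_left this (Nat.cast_nonneg N : (0 : ℝ) ≤ N)]
    _ = ∏ _i : Fin N,
        ENNReal.ofReal (2 * δ * (√Real.pi)⁻¹ * Real.exp (-(r + 1) ^ 2)) ^ 2 := by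
        rw [Finset.prod_const, Finset.card_univ, Fintype.card_fin, ← pow_mul,
          ENNReal.ofReal_pow (by positivity)]
    _ ≤ ∏ i : Fin N, complexGaussian {z | ‖z - w i‖ ≤ 2 * δ} := by
        gcongr with i
        exact le_complexGaussian_box hδ1 ((PiLp.norm_apply_le w i).trans hw)
    _ = Measure.pi (fun _ : Fin N => complexGaussian)
          (Set.univ.pi fun i => {z | ‖z - w i‖ ≤ 2 * δ}) := (Measure.pi_pi _ _).symm
    _ ≤ _ := by
        rw [channelLaw, MeasurableEquiv.map_apply]
        refine measure_mono fun z hz => ?_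
        simp only [Set.mem_preimage, Set.mem_ofPred_eq]
        have hsq : ‖(MeasurableEquiv.toLp 2 (Fin N → ℂ)) z - w‖ ^ 2 ≤ 1 := by
          rw [EuclideanSpace.norm_sq_eq]
          calc ∑ i, ‖((MeasurableEquiv.toLp 2 (Fin N → ℂ)) z - w) i‖ ^ 2
              ≤ ∑ _i : Fin N, (2 * δ) ^ 2 := by
                refine Finset.sum_le_sum fun i _ => ?_
                have := hz i (Set.mem_univ i)
                simp only [Set.mem_ofPred_eq] at this
                simp only [MeasurableEquiv.coe_toLp, PiLp.sub_apply]
                gcongr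
            _ = (N : ℝ) * (1 / ((N : ℝ) + 1)) ^ 2 := by
                simp only [Finset.sum_const, Finset.card_univ, Fintype.card_fin, nsmul_eq_mul, hδ]
                congr 2; field_simp
            _ ≤ 1 := by
                have hN : (0 : ℝ) ≤ N := Nat.cast_nonneg N
                rw [div_pow, one_pow, mul_one_div, div_le_iff₀ (by positivity)]
                nlinarith
        exact (sq_le_one_iff₀ (norm_nonneg _)).1 hsq

end ChannelLaw

/-! ### Joint measurability of the sum rate in codebook and channels -/

section Measurability

variable {N M : ℕ}

lemma measurable_shape : Measurable (shape : CVec N → CVec N) := by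
  unfold shape; fun_prop

variable {Ω : Type*} [MeasurableSpace Ω]

lemma Measurable.distortion {v s : Ω → CVec N} (hv : Measurable v) (hs : Measurable s) :
    Measurable fun ω => distortion (v ω) (s ω) := by
  unfold PU2RC.distortion
  exact measurable_const.sub ((hv.inner hs).norm.pow_const 2)

lemma Measurable.sinr (γ : ℝ) {F : Ω → Codebook N M} {h : Ω → CVec N} (hF : Measurable F)
    (hh : Measurable h) : Measurable fun ω => sinr γ (F ω) (h ω) := by
  have hq : Measurable fun ω => quantError (F ω) (h ω) := by
    unfold quantError
    exact Measurable.iInf fun p => Measurable.distortion (by fun_prop) (measurable_shape.comp hh)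
  unfold PU2RC.sinr
  fun_prop

lemma measurableSet_mem_users {F : Ω → Codebook N M} {h : Ω → ℕ → CVec N} (hF : Measurable F)
    (hh : Measurable h) (U u : ℕ) (m : Fin M) (n : Fin N) :
    MeasurableSet {ω | u ∈ users (F ω) (h ω) U m n} := by
  simp only [users, Finset.mem_filter, Finset.mem_range]
  have hF' : ∀ m n, Measurable fun ω => F ω m n := by fun_prop
  have hs : Measurable fun ω => shape (h ω u) := measurable_shape.comp (by fun_prop)
  have hlt : ∀ m' n', MeasurableSet {ω | F ω m' n' ≠ F ω m n →
      distortion (F ω m n) (shape (h ω u)) < distortion (F ω m' n') (shape (h ω u))} :=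
    fun m' n' => (measurableSet_eq_fun (hF' m' n') (hF' m n)).compl.imp
      (measurableSet_lt (Measurable.distortion (hF' m n) hs) (Measurable.distortion (hF' m' n') hs))
  have hall : MeasurableSet {ω | ∀ m' n', F ω m' n' ≠ F ω m n →
      distortion (F ω m n) (shape (h ω u)) < distortion (F ω m' n') (shape (h ω u))} := by
    convert MeasurableSet.iInter fun m' => MeasurableSet.iInter fun n' => hlt m' n' using 1
    ext ω
    simp only [Set.mem_iInter, Set.mem_ofPred_eq]
  exact (MeasurableSet.const (u < U)).inter hall

/-- The random index set takes values in the countable type `Finset ℕ`, so it is enough to treat the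
maximum over each fixed set. -/
lemma Measurable.maxSinr (γ : ℝ) {F : Ω → Codebook N M} {h : Ω → ℕ → CVec N} (hF : Measurable F)
    (hh : Measurable h) (U : ℕ) (m : Fin M) (n : Fin N) :
    Measurable fun ω => maxSinr γ (F ω) (h ω) U m n := by
  classical
  let _ : MeasurableSpace (Finset ℕ) := ⊤
  have hI : Measurable fun ω => users (F ω) (h ω) U m n := by
    refine measurable_to_countable' fun S => ?_
    have : (fun ω => users (F ω) (h ω) U m n) ⁻¹' {S}
        = ⋂ u : ℕ, {ω | u ∈ users (F ω) (h ω) U m n ↔ u ∈ S} := by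
      ext ω; simp [Finset.ext_iff]
    rw [this]
    exact MeasurableSet.iInter fun u => (measurableSet_mem_users hF hh U u m n).iff (.const _)
  have hf : Measurable fun p : Finset ℕ × Ω =>
      if hne : p.1.Nonempty then p.1.sup' hne fun u => PU2RC.sinr γ (F p.2) (h p.2 u) else 0 := by
    refine measurable_from_prod_countable_right fun S => ?_
    by_cases hS : S.Nonempty
    · simp only [hS, dite_true]
      have := Finset.measurable_sup' hS (f := fun u ω => PU2RC.sinr γ (F ω) (h ω u))
        fun u _ => Measurable.sinr γ hF (by fun_prop)
      convert this using 1
      ext ω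
      simp
    · simp only [hS, dite_false, measurable_const]
  exact hf.comp (hI.prodMk measurable_id)

lemma Measurable.sumRate (γ : ℝ) {F : Ω → Codebook N M} {h : Ω → ℕ → CVec N} (hF : Measurable F)
    (hh : Measurable h) (U : ℕ) : Measurable fun ω => sumRate γ (F ω) (h ω) U := by
  unfold PU2RC.sumRate
  exact Measurable.iSup fun m => Finset.measurable_sum _ fun n _ =>
    Real.measurable_log.comp (measurable_const.add (Measurable.maxSinr γ hF hh U m n))

end Measurability

end PU2RC

namespace PU2RC

/-- The joint law of the channels of all users. -/
noncomputable def userLaw (N : ℕ) : Measure (ℕ → CVec N) :=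
  Measure.infinitePi fun _ : ℕ => channelLaw N

instance (N : ℕ) : IsProbabilityMeasure (userLaw N) := by
  unfold userLaw; infer_instance

/-! ### Integrability and upper bound for the expected sum rate -/

section UpperBound

variable {N M : ℕ} {γ : ℝ}

/-- From `t + 1 ≤ exp t` at `t = (x - L)/2` one gets `x ≤ L + 2 exp(-L/2) exp(x/2)`; summing over
users dominates the maximum. Then `log(a + b) ≤ log a + b` for `a ≥ 1`, `b ≥ 0` takes the random
part out of the logarithm. -/
lemma sumRate_le_log_add (hγ : 0 ≤ γ) {F : Codebook N M} (hF : IsCodebook F) (h : ℕ → CVec N)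
    (U : ℕ) {L : ℝ} (hL : 0 ≤ L) :
    sumRate γ F h U ≤ N * (Real.log (1 + γ * L) +
      γ * (2 * Real.exp (-L / 2) * ∑ u ∈ Finset.range U, Real.exp (‖h u‖ ^ 2 / 2))) := by
  set S := 2 * Real.exp (-L / 2) * ∑ u ∈ Finset.range U, Real.exp (‖h u‖ ^ 2 / 2) with hS
  have hS0 : 0 ≤ S := by positivity
  have hK : 0 ≤ γ * L + γ * S := by positivity
  refine (sumRate_le hγ hF hK fun u hu => ?_).trans ?_
  · have h1 : Real.exp (‖h u‖ ^ 2 / 2) ≤ ∑ u ∈ Finset.range U, Real.exp (‖h u‖ ^ 2 / 2) :=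
      Finset.single_le_sum (f := fun u => Real.exp (‖h u‖ ^ 2 / 2))
        (fun _ _ => (Real.exp_pos _).le) (Finset.mem_range.2 hu)
    have h2 : ‖h u‖ ^ 2 ≤ L + S := by
      have h3 := Real.add_one_le_exp ((‖h u‖ ^ 2 - L) / 2)
      have h4 : Real.exp ((‖h u‖ ^ 2 - L) / 2) ≤ Real.exp (-L / 2) *
          ∑ u ∈ Finset.range U, Real.exp (‖h u‖ ^ 2 / 2) := by
        rw [show (‖h u‖ ^ 2 - L) / 2 = -L / 2 + ‖h u‖ ^ 2 / 2 by ring, Real.exp_add]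
        gcongr
      rw [hS]
      linarith
    nlinarith
  · gcongr
    have ha : 1 ≤ 1 + γ * L := by linarith [mul_nonneg hγ hL]
    have hγS : 0 ≤ γ * S := mul_nonneg hγ hS0
    have hlog := Real.log_le_sub_one_of_pos (x := (1 + (γ * L + γ * S)) / (1 + γ * L))
      (by positivity)
    rw [Real.log_div (by positivity) (by positivity)] at hlog
    have : (1 + (γ * L + γ * S)) / (1 + γ * L) - 1 = γ * S / (1 + γ * L) := by
      field_simp; ring
    rw [this] at hlog
    linarith [div_le_self hγS ha]

lemma ae_isCodebook_fst {ν : Measure (Codebook N M)} (hν : ∀ᵐ F ∂ν, IsCodebook F) :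
    ∀ᵐ p ∂(ν.prod (userLaw N)), IsCodebook p.1 :=
  measurePreserving_fst.quasiMeasurePreserving.ae hν

variable (ν : Measure (Codebook N M)) [IsProbabilityMeasure ν]

lemma measurePreserving_userLaw_eval (u : ℕ) :
    MeasurePreserving (fun p : Codebook N M × (ℕ → CVec N) => p.2 u)
      (ν.prod (userLaw N)) (channelLaw N) :=
  (measurePreserving_eval_infinitePi (fun _ : ℕ => channelLaw N) u).comp measurePreserving_snd

lemma integrable_exp_half_norm_sq_user (u : ℕ) :
    Integrable (fun p : Codebook N M × (ℕ → CVec N) => Real.exp (‖p.2 u‖ ^ 2 / 2))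
      (ν.prod (userLaw N)) :=
  (measurePreserving_userLaw_eval ν u).integrable_comp_of_integrable
    (integrable_exp_half_norm_sq_channelLaw N)

lemma integral_exp_half_norm_sq_user (u : ℕ) :
    ∫ p : Codebook N M × (ℕ → CVec N), Real.exp (‖p.2 u‖ ^ 2 / 2) ∂(ν.prod (userLaw N))
      = ∫ h, Real.exp (‖h‖ ^ 2 / 2) ∂(channelLaw N) := by
  rw [← (measurePreserving_userLaw_eval ν u).map_eq, integral_map (by fun_prop)
    (by fun_prop)]

variable {ν}

lemma integrable_sumRate (hγ : 0 ≤ γ) (hν : ∀ᵐ F ∂ν, IsCodebook F) (U : ℕ) :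
    Integrable (fun p : Codebook N M × (ℕ → CVec N) => sumRate γ p.1 p.2 U)
      (ν.prod (userLaw N)) := by
  -- The case `L = 0` already provides an integrable majorant.
  have hint : Integrable (fun p : Codebook N M × (ℕ → CVec N) => (N : ℝ) *
      (Real.log (1 + γ * 0) + γ * (2 * Real.exp (-0 / 2) *
        ∑ u ∈ Finset.range U, Real.exp (‖p.2 u‖ ^ 2 / 2)))) (ν.prod (userLaw N)) :=
    (((integrable_const _).add (((integrable_finsetSum _ fun u _ =>
      integrable_exp_half_norm_sq_user ν u).const_mul _).const_mul _)).const_mul _)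
  refine hint.mono'
    (Measurable.sumRate γ measurable_fst measurable_snd U).aestronglyMeasurable ?_
  filter_upwards [ae_isCodebook_fst hν] with p hp
  rw [Real.norm_of_nonneg (sumRate_nonneg hγ hp _ _)]
  exact sumRate_le_log_add hγ hp p.2 U le_rfl

/-- The choice `L = 2 log U` makes `exp(-L/2) = 1/U`, which cancels the `U` equal expectations in
the sum. -/
lemma integral_sumRate_le (hγ : 0 ≤ γ) (hν : ∀ᵐ F ∂ν, IsCodebook F) {U : ℕ} (hU : 1 ≤ U) :
    ∫ p : Codebook N M × (ℕ → CVec N), sumRate γ p.1 p.2 U ∂(ν.prod (userLaw N)) ≤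
      N * (Real.log (1 + 2 * γ * Real.log U)
        + 2 * γ * ∫ h, Real.exp (‖h‖ ^ 2 / 2) ∂(channelLaw N)) := by
  have hU0 : (0 : ℝ) < U := by exact_mod_cast hU
  have hL : 0 ≤ 2 * Real.log U := by
    have : 0 ≤ Real.log U := Real.log_nonneg (by exact_mod_cast hU)
    positivity
  have hsum : Integrable (fun p : Codebook N M × (ℕ → CVec N) =>
      ∑ u ∈ Finset.range U, Real.exp (‖p.2 u‖ ^ 2 / 2)) (ν.prod (userLaw N)) :=
    integrable_finsetSum _ fun u _ => integrable_exp_half_norm_sq_user ν u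
  have hint := (((integrable_const (Real.log (1 + γ * (2 * Real.log U)))).add
    ((hsum.const_mul (2 * Real.exp (-(2 * Real.log U) / 2))).const_mul γ)).const_mul (N : ℝ))
  refine (integral_mono_ae (integrable_sumRate hγ hν U) hint ?_).trans_eq ?_
  · filter_upwards [ae_isCodebook_fst hν] with p hp
    exact sumRate_le_log_add hγ hp p.2 U hL
  · simp only [Pi.add_apply]
    rw [integral_const_mul, integral_add (integrable_const _)
      ((hsum.const_mul _).const_mul γ), integral_const_mul, integral_const_mul,
      integral_finsetSum _ fun u _ => integrable_exp_half_norm_sq_user ν u]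
    simp only [integral_exp_half_norm_sq_user, integral_const, probReal_univ, one_smul,
      Finset.sum_const, Finset.card_range, nsmul_eq_mul]
    have he : Real.exp (-(2 * Real.log U) / 2) = (U : ℝ)⁻¹ := by
      rw [show -(2 * Real.log U) / 2 = -Real.log U by ring, Real.exp_neg, Real.exp_log hU0]
    rw [he, show γ * (2 * Real.log U) = 2 * γ * Real.log U by ring]
    field_simp

end UpperBound

/-! ### Lower bound for the expected sum rate -/

section LowerBound

variable {N M : ℕ} {γ : ℝ} {ν : Measure (Codebook N M)} [IsProbabilityMeasure ν]

lemma userLaw_forall_notMem (N : ℕ) {S : Set (CVec N)} (hS : MeasurableSet S) (U : ℕ) :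
    userLaw N {h | ∀ u < U, h u ∉ S} = channelLaw N Sᶜ ^ U := by
  have h1 : {h : ℕ → CVec N | ∀ u < U, h u ∉ S}
      = (↑(Finset.range U) : Set ℕ).pi fun _ => Sᶜ := by
    ext h; simp [Set.mem_pi]
  rw [h1, userLaw, Measure.infinitePi_pi _ fun _ _ => hS.compl]
  simp

/-- The probability that no user is near a given multiple of a given codeword is exponentially
small in the expected number of such users. -/
lemma prod_userLaw_no_user_le (hν : ∀ᵐ F ∂ν, IsCodebook F) {r q : ℝ} (hr : 0 ≤ r)
    (hq : ∀ w : CVec N, ‖w‖ ≤ r → ENNReal.ofReal q ≤ channelLaw N {h | ‖h - w‖ ≤ 1})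
    (U : ℕ) (m : Fin M) (n : Fin N) :
    (ν.prod (userLaw N)) {p | ∀ u < U, ¬ ‖p.2 u - (r : ℂ) • p.1 m n‖ ≤ 1}
      ≤ ENNReal.ofReal (Real.exp (-(U * q))) := by
  have hmeas : MeasurableSet {p : Codebook N M × (ℕ → CVec N) |
      ∀ u < U, ¬ ‖p.2 u - (r : ℂ) • p.1 m n‖ ≤ 1} := by
    have : {p : Codebook N M × (ℕ → CVec N) | ∀ u < U, ¬ ‖p.2 u - (r : ℂ) • p.1 m n‖ ≤ 1}
        = ⋂ u ∈ Set.Iio U, {p | ‖p.2 u - (r : ℂ) • p.1 m n‖ ≤ 1}ᶜ := by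
      ext p; simp
    rw [this]
    refine MeasurableSet.biInter (Set.to_countable _) fun u _ => MeasurableSet.compl ?_
    exact measurableSet_le (by fun_prop) measurable_const
  rw [Measure.prod_apply hmeas]
  refine (lintegral_mono_ae (g := fun _ => ENNReal.ofReal (Real.exp (-(U * q)))) ?_).trans_eq
    (by simp)
  filter_upwards [hν] with F hF
  have hball : MeasurableSet {h : CVec N | ‖h - (r : ℂ) • F m n‖ ≤ 1} :=
    measurableSet_le (by fun_prop) measurable_const
  have hle : channelLaw N {h : CVec N | ‖h - (r : ℂ) • F m n‖ ≤ 1}ᶜ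
      ≤ ENNReal.ofReal (Real.exp (-q)) := by
    rw [prob_compl_eq_one_sub hball]
    calc 1 - channelLaw N {h : CVec N | ‖h - (r : ℂ) • F m n‖ ≤ 1}
        ≤ 1 - ENNReal.ofReal q := by
          refine tsub_le_tsub_left (hq _ ?_) _
          rw [norm_smul, (hF.orthonormal m).1 n, Complex.norm_real, Real.norm_of_nonneg hr,
            mul_one]
      _ ≤ ENNReal.ofReal (Real.exp (-q)) := by
          refine tsub_le_iff_right.2 ?_
          rw [← ENNReal.ofReal_one]
          refine le_trans (ENNReal.ofReal_le_ofReal ?_) ENNReal.ofReal_add_le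
          linarith [Real.add_one_le_exp (-q)]
  calc _ = channelLaw N {h : CVec N | ‖h - (r : ℂ) • F m n‖ ≤ 1}ᶜ ^ U :=
        userLaw_forall_notMem N hball U
    _ ≤ ENNReal.ofReal (Real.exp (-q)) ^ U := by gcongr
    _ = _ := by
        rw [← ENNReal.ofReal_pow (Real.exp_pos _).le, ← Real.exp_nat_mul, mul_neg]

/-- The codebooks for which the coherence between any two distinct codewords is at most `β`. -/
def coherenceLE (N M : ℕ) (β : ℝ) : Set (Codebook N M) :=
  {F | ∀ m n m' n', F m' n' ≠ F m n → ‖(inner ℂ (F m n) (F m' n') : ℂ)‖ ≤ β}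

lemma measurableSet_coherenceLE (N M : ℕ) (β : ℝ) : MeasurableSet (coherenceLE N M β) := by
  have : coherenceLE N M β = ⋂ m, ⋂ n, ⋂ m', ⋂ n', ({F | F m' n' = F m n} ∪
      {F | ‖(inner ℂ (F m n) (F m' n') : ℂ)‖ ≤ β}) := by
    ext F; simp [coherenceLE, or_iff_not_imp_left]
  rw [this]
  refine MeasurableSet.iInter fun m => MeasurableSet.iInter fun n => MeasurableSet.iInter fun m' =>
    MeasurableSet.iInter fun n' => MeasurableSet.union ?_ ?_
  · exact measurableSet_eq_fun (by fun_prop) (by fun_prop)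
  · exact measurableSet_le (by fun_prop) measurable_const

/-- Continuity from above along `β = 1 - 1/(k+1)`: a codebook has finitely many pairs of codewords,
so its coherence is below some such `β`, and the intersection of the exceptional events is null. -/
lemma exists_measure_coherenceLE_compl_le (hν : ∀ᵐ F ∂ν, IsCodebook F) {η : ℝ} (hη : 0 < η) :
    ∃ β < 1, ν.real (coherenceLE N M β)ᶜ ≤ η := by
  have hanti : Antitone fun k : ℕ => (coherenceLE N M (1 - 1 / ((k : ℝ) + 1)))ᶜ := by
    refine fun k l hkl => Set.compl_subset_compl.2 fun F hF m n m' n' hne => ?_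
    refine (hF m n m' n' hne).trans ?_
    gcongr
  have hlim := tendsto_measure_iInter_atTop (μ := ν)
    (fun k => (measurableSet_coherenceLE N M _).compl.nullMeasurableSet) hanti
    ⟨0, measure_ne_top _ _⟩
  have hzero : ν (⋂ k : ℕ, (coherenceLE N M (1 - 1 / ((k : ℝ) + 1)))ᶜ) = 0 := by
    refine measure_mono_null ?_ (ae_iff.1 hν)
    intro F hF hcb
    have hex : ∃ k : ℕ, ∀ p : (Fin M × Fin N) × (Fin M × Fin N), F p.2.1 p.2.2 ≠ F p.1.1 p.1.2 →
        ‖(inner ℂ (F p.1.1 p.1.2) (F p.2.1 p.2.2) : ℂ)‖ ≤ 1 - 1 / ((k : ℝ) + 1) := by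
      have hev : ∀ p : (Fin M × Fin N) × (Fin M × Fin N), ∀ᶠ k : ℕ in atTop,
          F p.2.1 p.2.2 ≠ F p.1.1 p.1.2 →
          ‖(inner ℂ (F p.1.1 p.1.2) (F p.2.1 p.2.2) : ℂ)‖ ≤ 1 - 1 / ((k : ℝ) + 1) := by
        intro p
        by_cases hp : F p.2.1 p.2.2 ≠ F p.1.1 p.1.2
        · have hlt := hcb.noncollinear _ _ _ _ hp
          have ht : Tendsto (fun k : ℕ => 1 - 1 / ((k : ℝ) + 1)) atTop (𝓝 (1 - 0)) :=
            tendsto_one_div_add_atTop_nhds_zero_nat.const_sub 1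
          rw [sub_zero] at ht
          filter_upwards [ht.eventually (lt_mem_nhds hlt)] with k hk _ using hk.le
        · exact Eventually.of_forall fun k h => absurd h hp
      exact (eventually_all.2 hev).exists
    obtain ⟨k, hk⟩ := hex
    exact Set.mem_iInter.1 hF k fun m n m' n' => hk ((m, n), (m', n'))
  rw [hzero] at hlim
  obtain ⟨k, hk⟩ := (hlim.eventually (ge_mem_nhds
    (ENNReal.ofReal_pos.2 hη))).exists
  refine ⟨1 - 1 / ((k : ℝ) + 1), ?_, ENNReal.toReal_le_of_le_ofReal hη.le hk⟩
  have : (0 : ℝ) < 1 / ((k : ℝ) + 1) := by positivity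
  linarith

/-- Markov's inequality for the event that the sum rate reaches its target. Up to a null set,
failure requires large coherence or a codeword of one fixed basis with no user near its multiple by
`r`; a union bound over the `N` codewords suffices. -/
lemma le_integral_sumRate (hM : 1 ≤ M) (hγ : 0 < γ) (hν : ∀ᵐ F ∂ν, IsCodebook F) {r q β : ℝ}
    (hr : 1 < r) (hrβ : 2 < r * (1 - β))
    (hq : ∀ w : CVec N, ‖w‖ ≤ r → ENNReal.ofReal q ≤ channelLaw N {h | ‖h - w‖ ≤ 1}) (U : ℕ) :
    N * Real.log (1 + γ * (r - 1) ^ 2 / (1 + γ)) *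
      (1 - ν.real (coherenceLE N M β)ᶜ - N * Real.exp (-(U * q))) ≤
      ∫ p : Codebook N M × (ℕ → CVec N), sumRate γ p.1 p.2 U ∂(ν.prod (userLaw N)) := by
  set s := γ * (r - 1) ^ 2 / (1 + γ) with hs
  have hs0 : 0 ≤ s := by positivity
  set m₀ : Fin M := ⟨0, hM⟩
  set A : Set (Codebook N M × (ℕ → CVec N)) :=
    {p | N * Real.log (1 + s) ≤ sumRate γ p.1 p.2 U} with hA
  set E : Fin N → Set (Codebook N M × (ℕ → CVec N)) :=
    fun n => {p | ∀ u < U, ¬ ‖p.2 u - (r : ℂ) • p.1 m₀ n‖ ≤ 1} with hE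
  have hsub : Aᶜ ⊆ ({p | ¬ IsCodebook p.1} ∪ (coherenceLE N M β)ᶜ ×ˢ Set.univ) ∪ ⋃ n, E n := by
    intro p hp
    by_contra hcon
    simp only [Set.mem_union, Set.mem_ofPred_eq, Set.mem_prod, Set.mem_compl_iff, Set.mem_univ,
      and_true, Set.mem_iUnion, not_or, not_not, not_exists, hE, not_forall] at hcon
    obtain ⟨⟨hcb, hco⟩, hnear⟩ := hcon
    refine hp (le_sumRate hs0 m₀ fun n => ?_)
    obtain ⟨u, hu, hnear⟩ := hnear n
    exact ⟨u, mem_users_of_near hcb hu (by linarith) hrβ (fun m' n' => hco m₀ n m' n') hnear,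
      le_sinr_of_near hγ hcb hr hnear⟩
  have hAc : (ν.prod (userLaw N)).real Aᶜ
      ≤ ν.real (coherenceLE N M β)ᶜ + N * Real.exp (-(U * q)) := by
    refine (measureReal_mono hsub).trans ((measureReal_union_le _ _).trans (add_le_add ?_ ?_))
    · refine (measureReal_union_le _ _).trans ?_
      have h0 : (ν.prod (userLaw N)).real {p | ¬ IsCodebook p.1} = 0 := by
        rw [measureReal_def, ae_iff.1 (ae_isCodebook_fst hν), ENNReal.toReal_zero]
      rw [h0, zero_add, measureReal_def, Measure.prod_prod, measure_univ, mul_one, measureReal_def]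
    · refine (measureReal_iUnion_fintype_le _).trans ?_
      calc _ ≤ ∑ _n : Fin N, Real.exp (-(U * q)) := by
            refine Finset.sum_le_sum fun n _ => ENNReal.toReal_le_of_le_ofReal (Real.exp_pos _).le ?_
            exact prod_userLaw_no_user_le hν (by linarith) hq U m₀ n
        _ = _ := by simp
  have hAA : 1 ≤ (ν.prod (userLaw N)).real A + (ν.prod (userLaw N)).real Aᶜ := by
    have := measureReal_union_le (μ := ν.prod (userLaw N)) A Aᶜ
    rwa [Set.union_compl_self, probReal_univ] at this
  refine le_trans ?_ (mul_meas_ge_le_integral_of_nonneg ?_ (integrable_sumRate hγ.le hν U)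
    (N * Real.log (1 + s)))
  · refine mul_le_mul_of_nonneg_left (by linarith)
      (mul_nonneg (Nat.cast_nonneg _) (Real.log_nonneg (by linarith)))
  · filter_upwards [ae_isCodebook_fst hν] with p hp using sumRate_nonneg hγ.le hp _ _

end LowerBound

end PU2RC

namespace PU2RC

/-! ### Passage to the limit in the number of users -/

section Asymptotics

/-- `log φ(x) = log x + log(φ(x)/x)`, and the last term converges. Constant factors such as `2γ`
therefore do not affect the limit. -/
lemma tendsto_log_div_log {φ : ℝ → ℝ} {a : ℝ} (ha : 0 < a)
    (hφ : Tendsto (fun x => φ x / x) atTop (𝓝 a)) :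
    Tendsto (fun x => Real.log (φ x) / Real.log x) atTop (𝓝 1) := by
  have h1 : Tendsto (fun x => 1 + Real.log (φ x / x) / Real.log x) atTop (𝓝 (1 + 0)) :=
    (((Real.continuousAt_log ha.ne').tendsto.comp hφ).div_atTop
      Real.tendsto_log_atTop).const_add 1
  rw [add_zero] at h1
  refine h1.congr' ?_
  filter_upwards [hφ.eventually (lt_mem_nhds ha), eventually_gt_atTop 1] with x hx hx1
  have hφx : φ x ≠ 0 := by
    intro h0; simp [h0] at hx
  have hlog : Real.log x ≠ 0 := (Real.log_pos hx1).ne'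
  rw [Real.log_div hφx (by linarith)]
  field_simp
  ring

lemma tendsto_affine_div_self (a b : ℝ) :
    Tendsto (fun x : ℝ => (b + a * x) / x) atTop (𝓝 a) := by
  have h : Tendsto (fun x : ℝ => b / x + a) atTop (𝓝 (0 + a)) :=
    (tendsto_const_nhds.div_atTop tendsto_id).add_const a
  rw [zero_add] at h
  refine h.congr' ?_
  filter_upwards [eventually_gt_atTop 0] with x hx
  field_simp

lemma tendsto_sq_sqrt_sub_one_div_self (a κ : ℝ) :
    Tendsto (fun x : ℝ => (1 + a * (κ * √x - 1) ^ 2) / x) atTop (𝓝 (a * κ ^ 2)) := by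
  have h : Tendsto (fun x : ℝ => 1 / x + a * (κ - 1 / √x) ^ 2) atTop
      (𝓝 (0 + a * (κ - 0) ^ 2)) :=
    (tendsto_const_nhds.div_atTop tendsto_id).add
      (((tendsto_const_nhds.div_atTop Real.tendsto_sqrt_atTop).const_sub κ).pow 2 |>.const_mul a)
  rw [zero_add, sub_zero] at h
  refine h.congr' ?_
  filter_upwards [eventually_gt_atTop 0] with x hx
  have hs : 0 < √x := Real.sqrt_pos.2 hx
  have hx2 : x = √x ^ 2 := (Real.sq_sqrt hx.le).symm
  rw [add_div]
  congr 1
  rw [mul_div_assoc]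
  congr 1
  nth_rewrite 3 [hx2]
  field_simp

lemma tendsto_log_natCast_atTop : Tendsto (fun U : ℕ => Real.log U) atTop atTop :=
  Real.tendsto_log_atTop.comp tendsto_natCast_atTop_atTop

variable {N M : ℕ} {γ : ℝ} {ν : Measure (Codebook N M)} [IsProbabilityMeasure ν]

lemma eventually_le_scaled_integral (hN : 1 ≤ N) (hM : 1 ≤ M) (hγ : 0 < γ)
    (hν : ∀ᵐ F ∂ν, IsCodebook F) {a : ℝ} (ha : a < 1) : ∀ᶠ U : ℕ in atTop,
    a < (∫ p : Codebook N M × (ℕ → CVec N), sumRate γ p.1 p.2 U ∂(ν.prod (userLaw N))) /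
      (N * Real.log (Real.log U)) := by
  have hN0 : (0 : ℝ) < N := by exact_mod_cast hN
  obtain ⟨c, K, hc, hK, hcK⟩ := exists_le_channelLaw_closedBall N
  -- With this tolerance the limiting lower bound is at least `(1 + a)/2 > a`.
  obtain ⟨β, hβ, hβν⟩ := exists_measure_coherenceLE_compl_le hν
    (η := (1 - a) / 2) (by linarith)
  -- `K κ² = 1/2` makes the ball mass bound `c U^(-1/2)`, so the expected number of users in the
  -- ball is at least `c U^(1/2)`.
  set κ : ℝ := √(1 / (2 * K)) with hκ
  have hκ0 : 0 < κ := Real.sqrt_pos.2 (by positivity)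
  have hκ2 : K * κ ^ 2 = 1 / 2 := by
    rw [hκ, Real.sq_sqrt (by positivity)]; field_simp
  have hr : Tendsto (fun U : ℕ => κ * √(Real.log U)) atTop atTop :=
    (Real.tendsto_sqrt_atTop.comp tendsto_log_natCast_atTop).const_mul_atTop hκ0
  have hg : Tendsto (fun U : ℕ => Real.log (1 + γ / (1 + γ) * (κ * √(Real.log U) - 1) ^ 2) /
      Real.log (Real.log U)) atTop (𝓝 1) :=
    (tendsto_log_div_log (by positivity)
      (tendsto_sq_sqrt_sub_one_div_self (γ / (1 + γ)) κ)).comp tendsto_log_natCast_atTop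
  have hexp : Tendsto (fun U : ℕ => (N : ℝ) * Real.exp (-(c * Real.exp (Real.log U / 2))))
      atTop (𝓝 (N * 0)) := by
    refine Tendsto.const_mul _ (Real.tendsto_exp_neg_atTop_nhds_zero.comp ?_)
    exact (Real.tendsto_exp_atTop.comp
      (tendsto_log_natCast_atTop.atTop_div_const (by norm_num))).const_mul_atTop hc
  have hlim := hg.mul (hexp.const_sub (1 - ν.real (coherenceLE N M β)ᶜ))
  have hlt : a < 1 * (1 - ν.real (coherenceLE N M β)ᶜ - N * 0) := by linarith
  filter_upwards [hlim.eventually (lt_mem_nhds hlt), hr.eventually_gt_atTop 1,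
    hr.eventually_gt_atTop (2 / (1 - β)), eventually_ge_atTop 1,
    tendsto_log_natCast_atTop.eventually_gt_atTop 1] with U h1 h2 h3 hU hlog
  refine h1.trans_le ?_
  have hloglog : 0 < Real.log (Real.log U) := Real.log_pos hlog
  have hU0 : (0 : ℝ) < U := by exact_mod_cast hU
  rw [div_lt_iff₀ (by linarith)] at h3
  have hmain := le_integral_sumRate (U := U) hM hγ hν h2 h3 (fun w hw => hcK w _ h2.le hw)
  have hUq : (U : ℝ) * (c * Real.exp (-K * (κ * √(Real.log U)) ^ 2))
      = c * Real.exp (Real.log U / 2) := by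
    rw [mul_pow, Real.sq_sqrt (show 0 ≤ Real.log U by linarith)]
    nth_rewrite 1 [← Real.exp_log hU0]
    rw [mul_left_comm, ← Real.exp_add]
    congr 2
    linear_combination (-Real.log U) * hκ2
  rw [hUq] at hmain
  rw [le_div_iff₀ (by positivity)]
  refine le_of_eq_of_le ?_ hmain
  rw [div_mul_eq_mul_div γ]
  field_simp

lemma eventually_scaled_integral_le (hN : 1 ≤ N) (hγ : 0 < γ)
    (hν : ∀ᵐ F ∂ν, IsCodebook F) {b : ℝ} (hb : 1 < b) : ∀ᶠ U : ℕ in atTop,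
    (∫ p : Codebook N M × (ℕ → CVec N), sumRate γ p.1 p.2 U ∂(ν.prod (userLaw N))) /
      (N * Real.log (Real.log U)) < b := by
  have hN0 : (0 : ℝ) < N := by exact_mod_cast hN
  set C := ∫ h, Real.exp (‖h‖ ^ 2 / 2) ∂(channelLaw N)
  have h1 : Tendsto (fun U : ℕ => Real.log (1 + 2 * γ * Real.log U) / Real.log (Real.log U))
      atTop (𝓝 1) :=
    (tendsto_log_div_log (by positivity) (tendsto_affine_div_self (2 * γ) 1)).comp
      tendsto_log_natCast_atTop
  have h2 : Tendsto (fun U : ℕ => 2 * γ * C / Real.log (Real.log U)) atTop (𝓝 0) :=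
    tendsto_const_nhds.div_atTop (Real.tendsto_log_atTop.comp tendsto_log_natCast_atTop)
  have hlim := h1.add h2
  rw [add_zero] at hlim
  filter_upwards [hlim.eventually (gt_mem_nhds hb), eventually_ge_atTop 1,
    tendsto_log_natCast_atTop.eventually_gt_atTop 1] with U hlt hU hlog
  refine lt_of_le_of_lt ?_ hlt
  have hloglog : 0 < Real.log (Real.log U) := Real.log_pos hlog
  rw [← add_div, div_le_div_iff₀ (by positivity) hloglog]
  calc _ ≤ N * (Real.log (1 + 2 * γ * Real.log U) + 2 * γ * C) * Real.log (Real.log U) := by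
        gcongr
        exact integral_sumRate_le hγ.le hν hU
    _ = _ := by ring

end Asymptotics

/-! ### Scaling law for an independent random codebook -/

section ScalingLaw

variable {N M : ℕ}

lemma measurableSet_isCodebook : MeasurableSet {F : Codebook N M | IsCodebook F} := by
  have : {F : Codebook N M | IsCodebook F}
      = (⋂ m, ⋂ n, ⋂ n', {F | (inner ℂ (F m n) (F m n') : ℂ) = if n = n' then 1 else 0}) ∩
        ⋂ m, ⋂ n, ⋂ m', ⋂ n', ({F | F m' n' = F m n} ∪
          {F | ‖(inner ℂ (F m n) (F m' n') : ℂ)‖ < 1}) := by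
    ext F
    simp only [Set.mem_ofPred_eq, Set.mem_inter_iff, Set.mem_iInter, Set.mem_union]
    refine ⟨fun h => ⟨fun m => orthonormal_iff_ite.1 (h.orthonormal m), fun m n m' n' =>
      or_iff_not_imp_left.2 (h.noncollinear m n m' n')⟩, fun h => ⟨fun m =>
      orthonormal_iff_ite.2 (h.1 m), fun m n m' n' => or_iff_not_imp_left.1 (h.2 m n m' n')⟩⟩
  rw [this]
  refine MeasurableSet.inter ?_ ?_
  · exact MeasurableSet.iInter fun m => MeasurableSet.iInter fun n => MeasurableSet.iInter
      fun n' => measurableSet_eq_fun (by fun_prop) measurable_const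
  · exact MeasurableSet.iInter fun m => MeasurableSet.iInter fun n => MeasurableSet.iInter
      fun m' => MeasurableSet.iInter fun n' => MeasurableSet.union
        (measurableSet_eq_fun (by fun_prop) (by fun_prop))
        (measurableSet_lt (by fun_prop) measurable_const)

/-- The scaling law for a random codebook independent of the channels. -/
theorem scalingLaw_of_indepFun {Ω : Type*} [MeasurableSpace Ω] {μ : Measure Ω}
    [IsProbabilityMeasure μ] (hN : 1 ≤ N) (hM : 1 ≤ M) {γ : ℝ} (hγ : 0 < γ)
    {H : ℕ → Ω → CVec N} (hlaw : ∀ u, HasLaw (H u) (channelLaw N) μ) (hind : iIndepFun H μ)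
    {F : Ω → Codebook N M} (hFm : AEMeasurable F μ) (hF : ∀ᵐ ω ∂μ, IsCodebook (F ω))
    (hHF : IndepFun (fun ω u => H u ω) F μ) : ScalingLaw μ γ F H := by
  have hHm : AEMeasurable (fun ω u => H u ω) μ :=
    aemeasurable_pi_iff.2 fun u => (hlaw u).aemeasurable
  have hHmap : μ.map (fun ω u => H u ω) = userLaw N := by
    rw [hind.map_fun_eq_infinitePi_map₀ hHm, userLaw]
    congr 1
    ext1 u
    exact (hlaw u).map_eq
  set ν := μ.map F with hνdef
  have : IsProbabilityMeasure ν := Measure.isProbabilityMeasure_map hFm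
  have hν : ∀ᵐ F ∂ν, IsCodebook F := (ae_map_iff hFm measurableSet_isCodebook).2 hF
  -- Only the joint law matters, and independence makes it the product measure of the two bounds.
  have hjoint : μ.map (fun ω => (F ω, fun u => H u ω)) = ν.prod (userLaw N) := by
    rw [(indepFun_iff_map_prod_eq_prod_map_map hFm hHm).1 hHF.symm, hHmap]
  have hsm : ∀ U, AEStronglyMeasurable (fun p : Codebook N M × (ℕ → CVec N) =>
      sumRate γ p.1 p.2 U) (μ.map (fun ω => (F ω, fun u => H u ω))) := fun U =>
    (Measurable.sumRate γ measurable_fst measurable_snd U).aestronglyMeasurable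
  have hthr : ∀ U, throughput μ γ F H U = ∫ p : Codebook N M × (ℕ → CVec N),
      sumRate γ p.1 p.2 U ∂(ν.prod (userLaw N)) := fun U => by
    rw [← hjoint, integral_map (hFm.prodMk hHm) (hsm U), throughput]
  refine ⟨fun U => ?_, ?_⟩
  · refine (integrable_map_measure (hsm U) (hFm.prodMk hHm)).1 ?_
    rw [hjoint]
    exact integrable_sumRate hγ.le hν U
  · simp only [hthr]
    exact tendsto_order.2 ⟨fun a ha => eventually_le_scaled_integral hN hM hγ hν ha,
      fun b hb => eventually_scaled_integral_le hN hγ hν hb⟩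

end ScalingLaw

end PU2RC

namespace PU2RC

/-! ### Haar codebooks almost surely have no collinear distinct codewords -/

section Haar

variable {N M : ℕ}

instance (N : ℕ) : IsProbabilityMeasure (haarUnitary N) :=
  ⟨by simpa [haarUnitary] using
    Measure.haarMeasure_self (K₀ := (⊤ : TopologicalSpace.PositiveCompacts (UnitaryMat N)))⟩

instance (N : ℕ) : (haarUnitary N).IsMulLeftInvariant := by
  unfold haarUnitary; infer_instance

/-- A column of a unitary matrix. -/
def unitaryCol (n : Fin N) (A : UnitaryMat N) : CVec N := WithLp.toLp 2 fun i => A.1 i n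

lemma measurable_unitaryCol (n : Fin N) : Measurable (unitaryCol n) := by
  refine Continuous.measurable ?_
  refine (PiLp.continuous_toLp 2 _).comp (continuous_pi fun i => ?_)
  exact (continuous_apply n).comp ((continuous_apply i).comp continuous_subtype_val)

lemma inner_unitaryCol (A B : UnitaryMat N) (n n' : Fin N) :
    (inner ℂ (unitaryCol n A) (unitaryCol n' B) : ℂ) = (A⁻¹ * B).1 n n' := by
  change _ = (star A.1 * B.1) n n'
  simp [unitaryCol, PiLp.inner_apply, Matrix.mul_apply, Matrix.star_apply, mul_comm]

lemma orthonormal_unitaryCol (A : UnitaryMat N) : Orthonormal ℂ fun n => unitaryCol n A := by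
  rw [orthonormal_iff_ite]
  intro n n'
  rw [inner_unitaryCol, inv_mul_cancel]
  rfl

lemma exists_unitaryCol_eq {x : CVec N} (hx : ‖x‖ = 1) (n : Fin N) :
    ∃ A : UnitaryMat N, unitaryCol n A = x := by
  obtain ⟨b, hb⟩ := Orthonormal.exists_orthonormalBasis_extension_of_card_eq (𝕜 := ℂ)
    (E := CVec N) (ι := Fin N) (by simp) (v := fun _ => x) (s := {n})
    ((orthonormal_subsingleton_iff).2 fun _ => hx)
  refine ⟨⟨(EuclideanSpace.basisFun (Fin N) ℂ).toBasis.toMatrix b,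
    OrthonormalBasis.toMatrix_orthonormalBasis_mem_unitary _ _⟩, ?_⟩
  ext i
  rw [← hb n rfl]
  simp [unitaryCol, Module.Basis.toMatrix_apply]

/-- If `A` is unitary with `n`-th column `z/‖z‖`, then alignment of `W` with `z` says that the `(n,
n)` entry of `A⁻¹ W` has modulus 1; by left invariance its probability does not depend on `z`. -/
lemma haarUnitary_aligned_eq {x y : CVec N} (hx : x ≠ 0) (hy : y ≠ 0) (n : Fin N) :
    haarUnitary N {W | ‖(inner ℂ x (unitaryCol n W) : ℂ)‖ = ‖x‖} =
      haarUnitary N {W | ‖(inner ℂ y (unitaryCol n W) : ℂ)‖ = ‖y‖} := by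
  suffices h : ∀ z : CVec N, z ≠ 0 →
      haarUnitary N {W | ‖(inner ℂ z (unitaryCol n W) : ℂ)‖ = ‖z‖} =
        haarUnitary N {W | ‖W.1 n n‖ = 1} from (h x hx).trans (h y hy).symm
  intro z hz
  have hz0 : 0 < ‖z‖ := norm_pos_iff.2 hz
  obtain ⟨A, hA⟩ := exists_unitaryCol_eq (x := ((‖z‖⁻¹ : ℝ) : ℂ) • z)
    (by rw [norm_smul, Complex.norm_real, norm_inv, norm_norm, inv_mul_cancel₀ hz0.ne']) n
  rw [← measure_preimage_mul (haarUnitary N) A⁻¹ {W | ‖W.1 n n‖ = 1}]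
  congr 1
  ext W
  simp only [Set.mem_preimage, Set.mem_ofPred_eq]
  rw [← inner_unitaryCol, hA, inner_smul_left, norm_mul, RCLike.norm_conj, Complex.norm_real,
    norm_inv, norm_norm, inv_mul_eq_one₀ hz0.ne', eq_comm]

/-- A column of a Haar unitary matrix is almost surely not collinear with a given vector: the
events for infinitely many pairwise non-collinear vectors are disjoint and equally likely. -/
lemma haarUnitary_aligned_eq_zero (hN : 2 ≤ N) {x : CVec N} (hx : x ≠ 0) (n : Fin N) :
    haarUnitary N {W | ‖(inner ℂ x (unitaryCol n W) : ℂ)‖ = ‖x‖} = 0 := by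
  set i₀ : Fin N := ⟨0, by omega⟩
  set i₁ : Fin N := ⟨1, by omega⟩
  have hi : i₁ ≠ i₀ := by simp [i₀, i₁]
  -- The vectors `e₀ + k e₁` are pairwise non-collinear; two coordinates are needed, hence `2 ≤ N`.
  set y : ℕ → CVec N := fun k =>
    EuclideanSpace.single i₀ (1 : ℂ) + EuclideanSpace.single i₁ (k : ℂ) with hy
  have hy0 : ∀ k, y k i₀ = 1 := fun k => by simp [hy, hi.symm]
  have hy1 : ∀ k, y k i₁ = k := fun k => by simp [hy, hi]
  have hyne : ∀ k, y k ≠ 0 := fun k h => by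
    have := hy0 k
    simp [h] at this
  by_contra hpos
  set S : ℕ → Set (UnitaryMat N) :=
    fun k => {W | ‖(inner ℂ (y k) (unitaryCol n W) : ℂ)‖ = ‖y k‖} with hS
  have hmeas : ∀ k, MeasurableSet (S k) := fun k =>
    measurableSet_eq_fun ((measurable_const.inner (measurable_unitaryCol n)).norm)
      measurable_const
  have hdisj : Pairwise (Function.onFun Disjoint S) := by
    intro k l hkl
    refine Set.disjoint_left.2 fun W hk hl => hkl ?_
    have hW : ‖unitaryCol n W‖ = 1 := (orthonormal_unitaryCol W).1 n
    have hW0 : unitaryCol n W ≠ 0 := norm_ne_zero_iff.1 (by rw [hW]; exact one_ne_zero)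
    have hcol : ∀ k, W ∈ S k → ∃ r : ℂ, unitaryCol n W = r • y k := fun k hk => by
      have h1 : ‖(inner ℂ (y k) (unitaryCol n W) : ℂ)‖ = ‖y k‖ * ‖unitaryCol n W‖ := by
        rw [hW, mul_one]; exact hk
      have h2 := ((norm_inner_eq_norm_tfae ℂ (y k) (unitaryCol n W)).out 0 2).1 h1
      exact h2.resolve_left (hyne k)
    obtain ⟨r, hr⟩ := hcol k hk
    obtain ⟨t, ht⟩ := hcol l hl
    have he : r • y k = t • y l := hr.symm.trans ht
    have e0 := congrArg (fun v : CVec N => v i₀) he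
    have e1 := congrArg (fun v : CVec N => v i₁) he
    simp only [PiLp.smul_apply, hy0, hy1, smul_eq_mul, mul_one] at e0 e1
    have hr0 : r ≠ 0 := fun h0 => hW0 (by rw [hr, h0, zero_smul])
    rw [← e0] at e1
    exact_mod_cast mul_left_cancel₀ hr0 e1
  -- A finite measure allows only finitely many disjoint sets of mass at least a given positive
  -- number.
  have hfin := Measure.finite_const_le_meas_of_disjoint_iUnion (haarUnitary N)
    (pos_iff_ne_zero.2 hpos) hmeas hdisj (measure_ne_top _ _)
  refine Set.infinite_univ (hfin.subset fun k _ => ?_)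
  exact (haarUnitary_aligned_eq hx (hyne k) n).le

variable {Ω : Type*} [MeasurableSpace Ω] {μ : Measure Ω} [IsProbabilityMeasure μ]

/-- By independence and Fubini the column of `A` may be frozen at a unit vector; equality in
Cauchy–Schwarz is then a null event for the column of `B`. -/
lemma ae_norm_inner_unitaryCol_lt_one (hN : 2 ≤ N) {A B : Ω → UnitaryMat N}
    (hA : HasLaw A (haarUnitary N) μ) (hB : HasLaw B (haarUnitary N) μ) (hAB : IndepFun A B μ)
    (n n' : Fin N) :
    ∀ᵐ ω ∂μ, ‖(inner ℂ (unitaryCol n (A ω)) (unitaryCol n' (B ω)) : ℂ)‖ < 1 := by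
  have hcol : IndepFun (unitaryCol n ∘ A) (unitaryCol n' ∘ B) μ :=
    hAB.comp (measurable_unitaryCol n) (measurable_unitaryCol n')
  have hAm := (measurable_unitaryCol n).comp_aemeasurable hA.aemeasurable
  have hBm := (measurable_unitaryCol n').comp_aemeasurable hB.aemeasurable
  have hjoint := (indepFun_iff_map_prod_eq_prod_map_map hAm hBm).1 hcol
  have hmeas : MeasurableSet {p : CVec N × CVec N | ‖(inner ℂ p.1 p.2 : ℂ)‖ < 1} :=
    measurableSet_lt (by fun_prop) measurable_const
  refine (ae_map_iff (hAm.prodMk hBm) hmeas).1 ?_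
  rw [hjoint, ae_iff]
  refine (Measure.measure_prod_null hmeas.compl).2 ?_
  have hnorm : ∀ᵐ v ∂(μ.map (unitaryCol n ∘ A)), ‖v‖ = 1 :=
    (ae_map_iff hAm (measurableSet_eq_fun measurable_norm measurable_const)).2
      (ae_of_all _ fun ω => (orthonormal_unitaryCol (A ω)).1 n)
  filter_upwards [hnorm] with v hv
  have hv0 : v ≠ 0 := norm_ne_zero_iff.1 (by rw [hv]; exact one_ne_zero)
  rw [← AEMeasurable.map_map_of_aemeasurable (measurable_unitaryCol n').aemeasurable hB.aemeasurable,
    hB.map_eq, Measure.map_apply (measurable_unitaryCol n') (measurable_prodMk_left hmeas.compl)]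
  refine measure_mono_null (fun W hW => ?_) (haarUnitary_aligned_eq_zero hN hv0 n')
  have hW' : ¬ ‖(inner ℂ v (unitaryCol n' W) : ℂ)‖ < 1 := hW
  have hle := norm_inner_le_norm (𝕜 := ℂ) v (unitaryCol n' W)
  rw [(orthonormal_unitaryCol W).1 n', mul_one] at hle
  exact le_antisymm hle (hv ▸ not_lt.1 hW')

lemma measurable_codebookOfUnitary :
    Measurable (codebookOfUnitary : (Fin M → UnitaryMat N) → Codebook N M) :=
  measurable_pi_lambda _ fun m => measurable_pi_lambda _ fun n =>
    (measurable_unitaryCol n).comp (measurable_pi_apply m)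

lemma ae_isCodebook_codebookOfUnitary (hN : 2 ≤ N) {B : Fin M → Ω → UnitaryMat N}
    (hB : ∀ m, HasLaw (B m) (haarUnitary N) μ) (hind : iIndepFun B μ) :
    ∀ᵐ ω ∂μ, IsCodebook (codebookOfUnitary fun m => B m ω) := by
  have hne : ∀ᵐ ω ∂μ, ∀ m n m' n', m ≠ m' →
      ‖(inner ℂ (unitaryCol n (B m ω)) (unitaryCol n' (B m' ω)) : ℂ)‖ < 1 := by
    simp only [ae_all_iff]
    exact fun m n m' n' hm =>
      ae_norm_inner_unitaryCol_lt_one hN (hB m) (hB m') (hind.indepFun hm) n n'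
  filter_upwards [hne] with ω hω
  refine ⟨fun m => orthonormal_unitaryCol (B m ω), fun m n m' n' hF => ?_⟩
  by_cases hm : m = m'
  · subst hm
    have hn : n ≠ n' := fun h => hF (by rw [h])
    have := (orthonormal_unitaryCol (B m ω)).2 hn
    change ‖(inner ℂ (unitaryCol n (B m ω)) (unitaryCol n' (B m ω)) : ℂ)‖ < 1
    rw [this, norm_zero]
    exact one_pos
  · exact hω m n m' n' hm

end Haar

end PU2RC

theorem proposition1 {Ω : Type*} [MeasurableSpace Ω] (μ : Measure Ω) [IsProbabilityMeasure μ]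
    (N M : ℕ) (hN : 1 ≤ N) (hM : 1 ≤ M) (P : ℝ) (hP : 0 < P)
    (H : ℕ → Ω → PU2RC.CVec N)
    (hlaw : ∀ u, HasLaw (H u) (PU2RC.channelLaw N) μ) (hind : iIndepFun H μ) :
    (∀ F : PU2RC.Codebook N M, PU2RC.IsCodebook F →
      PU2RC.ScalingLaw μ (P / N) (fun _ => F) H) ∧
    (2 ≤ N → ∀ B : Fin M → Ω → PU2RC.UnitaryMat N,
      (∀ m, HasLaw (B m) (PU2RC.haarUnitary N) μ) → iIndepFun B μ →
      IndepFun (fun ω u => H u ω) (fun ω m => B m ω) μ →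
      PU2RC.ScalingLaw μ (P / N) (fun ω => PU2RC.codebookOfUnitary fun m => B m ω) H) := by
  have hγ : 0 < P / N := div_pos hP (by exact_mod_cast hN)
  refine ⟨fun F hF => ?_, fun hN2 B hB hBind hHB => ?_⟩
  · exact PU2RC.scalingLaw_of_indepFun hN hM hγ hlaw hind aemeasurable_const
      (ae_of_all _ fun _ => hF) (indepFun_const_right _ F)
  · refine PU2RC.scalingLaw_of_indepFun hN hM hγ hlaw hind ?_
      (PU2RC.ae_isCodebook_codebookOfUnitary hN2 hB hBind)
      (hHB.comp measurable_id PU2RC.measurable_codebookOfUnitary)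
    exact PU2RC.measurable_codebookOfUnitary.comp_aemeasurable
      (aemeasurable_pi_iff.2 fun m => (hB m).aemeasurable)
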